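/- Let $n\ge 0$ be an integer and let $J=(a_1,a_2)\cup(a_3,a_4)\cup\dots\cup(a_{2m-1},a_{2m})\subset\mathbb R$, $m\ge1$, $-\infty\le a_1<a_2<\dots<a_{2m}\le\infty$, be a finite union of intervals. Let $V$ be a real potential and, for $t\in\mathbb R$, let $$\tau_n^J(t)=\frac1{n!}\int_{J^n}\prod_{1\le i<j\le n}(x_j-x_i)^2\prod_{i=1}^n e^{-V(x_i)+t x_i}\,dx_1\cdots dx_n\qquad(\tau_0^J=1)$$ be the matrix integral of the unitary ensemble with weight $e^{-V(x)}$, modified by the first Toda time $t=t_1$ and restricted to $J$. Fix an index $k$ and let the endpoint $\xi=a_k$ of $J$ vary over the real values between the two neighbouring endpoints, the other endpoints being fixed. Consider points $(\xi,t)$ such that $V$ is differentiable in a neighbourhood of $\xi$ and $\int_J e^{-V(x)+sx}\,dx<\infty$ for all $s$ in a neighbourhood of $t$. At such points $\tau_n^J>0$, $\tau_{n+1}^J>0$, the function $$T_+(\xi,t)=\ln\frac{\tau_{n+1}^J(t)}{\tau_n^J(t)}$$ has all the partial derivatives written below, and, wherever $T_+'\neq0$, it satisfies the universal PDE $$(T_+'')_{tt}-\frac{(T_+')_{tt}\,T_+''}{T_+'}-(T_+')^2(T_+)_{tt}-\frac{(T_+')_t(T_+'')_t}{T_+'}+\frac{\big((T_+')_t\big)^2\,T_+''}{(T_+')^2}+\big(\xi-(T_+)_t\big)\,T_+'\,\big(2(T_+')_t-1\big)=0,$$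 where the prime denotes $\partial/\partial\xi$ and the subscript $t$ denotes $\partial/\partial t$. -/

import Mathlib

open Set Filter Topology MeasureTheory

noncomputable section

/-- The finite union of intervals `(a₀, a₁) ∪ (a₂, a₃) ∪ … ∪ (a₂ₘ₋₂, a₂ₘ₋₁)` of the real line
with (possibly infinite) endpoints `a`. -/
def intervalUnion {m : ℕ} (a : Fin (2 * m) → EReal) : Set ℝ :=
  ⋃ i : Fin m, {x : ℝ | a ⟨2 * i, by omega⟩ < (x : EReal) ∧ (x : EReal) < a ⟨2 * i + 1, by omega⟩}

/-- The weight `exp (-V(x) + t₁ x)`: the weight `exp (-V(x))` modified by the first Toda time. -/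
def todaWeight (V : ℝ → ℝ) (t x : ℝ) : ℝ :=
  Real.exp (-V x + t * x)

/-- The matrix integral
`τ_n^J(t₁) = (1 / n!) ∫_{Jⁿ} Δ_n(x)² ∏ᵢ exp (-V(xᵢ) + t₁ xᵢ) dx₁ ⋯ dxₙ`,
where `Δ_n` is the Vandermonde determinant. -/
def matrixIntegral (V : ℝ → ℝ) (n : ℕ) (J : Set ℝ) (t : ℝ) : ℝ :=
  (n.factorial : ℝ)⁻¹ *
    ∫ x in Set.pi Set.univ (fun _ : Fin n => J),
      (Matrix.vandermonde x).det ^ 2 * ∏ i, todaWeight V t (x i)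

/-- The function `T_+ = ln (τ_{n+1}^J / τ_n^J)` of the `k`-th endpoint `ξ` of `J` and of `t = t₁`,
the other endpoints being kept fixed. -/
def logRatio (V : ℝ → ℝ) {m : ℕ} (a : Fin (2 * m) → EReal) (k : Fin (2 * m)) (n : ℕ)
    (ξ t : ℝ) : ℝ :=
  Real.log (matrixIntegral V (n + 1) (intervalUnion (Function.update a k (ξ : EReal))) t /
    matrixIntegral V n (intervalUnion (Function.update a k (ξ : EReal))) t)

/-- Partial derivative with respect to the first variable `ξ`. -/
def dXi (F : ℝ → ℝ → ℝ) (ξ t : ℝ) : ℝ :=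
  deriv (fun x => F x t) ξ

/-- Partial derivative with respect to the second variable `t`. -/
def dT (F : ℝ → ℝ → ℝ) (ξ t : ℝ) : ℝ :=
  deriv (fun s => F ξ s) t

end

/-! Let L be integration over J against the weight w, p_j its monic orthogonal polynomials, h_j =
L(p_j²), b_n the diagonal recurrence coefficient and K_n the reproducing kernel. Expanding the
squared Vandermonde determinant in the p_j gives τ_n = h_0 ⋯ h_{n-1} (`matrixIntegral_eq_prod`), so
T = ln h_n.

Both variables deform L simply: ∂_t inserts a factor x, and ∂_ξ is ε w(ξ) times evaluation at ξ,
with ε = -1 at a left endpoint and ε = 1 at a right one. Differentiating the orthogonality relations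
(`hasPolyDerivAt_op`, `hasDerivAt_nrm`) yields T_t = b_n, ∂_t p_n = -(h_n/h_{n-1}) p_{n-1}, T' = ε
w(ξ) p_n(ξ)²/h_n and ∂_ξ p_n = -ε w(ξ) p_n(ξ) K_n(·, ξ).

Put S = ε w(ξ) K_n(ξ, ξ). By `IsPos.christoffel_darboux`, (T'')_t = (T')_t T''/T' + 2S + T' - (ξ -
T_t)(T')². The only foreign quantity is S, and the t-derivative of its sum telescopes
(`hasDerivAt_ker_toda`) to give 2S_t = (ξ - T_t)T' - (T')_t. One more t-derivative therefore
eliminates S and leaves the PDE (`pde_of_system`). -/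

open Polynomial

namespace OrthoPoly

/-! ### Orthogonal polynomials of a positive functional -/

/-- The pair of the monic orthogonal polynomial `pₙ` of the functional `L` and of
`(hₙ / hₙ₋₁) pₙ₋₁` (zero for `n = 0`), where `hₙ = L (pₙ²)`, built by the three-term recurrence. -/
noncomputable def opPair (L : ℝ[X] →ₗ[ℝ] ℝ) : ℕ → ℝ[X] × ℝ[X]
  | 0 => (1, 0)
  | n + 1 =>
    let p := (opPair L n).1
    let q := (X - C (L (X * p * p) / L (p * p))) * p - (opPair L n).2
    (q, C (L (q * q) / L (p * p)) * p)

/-- The monic orthogonal polynomial of degree `n` of the functional `L`. -/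
noncomputable def op (L : ℝ[X] →ₗ[ℝ] ℝ) (n : ℕ) : ℝ[X] := (opPair L n).1

/-- The last term `(hₙ / hₙ₋₁) pₙ₋₁` of the three-term recurrence. -/
noncomputable def prev (L : ℝ[X] →ₗ[ℝ] ℝ) (n : ℕ) : ℝ[X] := (opPair L n).2

/-- The squared norm `hₙ = L (pₙ²)`. -/
noncomputable def nrm (L : ℝ[X] →ₗ[ℝ] ℝ) (n : ℕ) : ℝ := L (op L n * op L n)

/-- The diagonal recurrence coefficient `L (x pₙ²) / hₙ`. -/
noncomputable def diag (L : ℝ[X] →ₗ[ℝ] ℝ) (n : ℕ) : ℝ := L (X * op L n * op L n) / nrm L n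

/-- The reproducing kernel `∑_{j < n} pⱼ(y) pⱼ / hⱼ`. -/
noncomputable def ker (L : ℝ[X] →ₗ[ℝ] ℝ) (n : ℕ) (y : ℝ) : ℝ[X] :=
  ∑ j ∈ Finset.range n, C ((op L j).eval y / nrm L j) * op L j

/-- A functional that is positive on nonzero squares. -/
def IsPos (L : ℝ[X] →ₗ[ℝ] ℝ) : Prop := ∀ q : ℝ[X], q ≠ 0 → 0 < L (q * q)

section algebra

variable (L : ℝ[X] →ₗ[ℝ] ℝ)

theorem op_zero : op L 0 = 1 := rfl

theorem prev_zero : prev L 0 = 0 := rfl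

theorem op_succ (n : ℕ) : op L (n + 1) = (X - C (diag L n)) * op L n - prev L n := rfl

theorem prev_succ (n : ℕ) : prev L (n + 1) = C (nrm L (n + 1) / nrm L n) * op L n := rfl

theorem map_C_mul (c : ℝ) (q : ℝ[X]) : L (C c * q) = c * L q := by
  rw [← smul_eq_C_mul, map_smul, smul_eq_mul]

theorem degree_C_mul_le (c : ℝ) (q : ℝ[X]) : (C c * q).degree ≤ q.degree := by
  rw [← smul_eq_C_mul]
  exact degree_smul_le c q

theorem op_monic_natDegree_prev (n : ℕ) :
    (op L n).Monic ∧ (op L n).natDegree = n ∧ (prev L n).degree < n := by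
  induction n with
  | zero => simp [op_zero, prev_zero]
  | succ n ih =>
    obtain ⟨hm, hd, hA⟩ := ih
    have h1 : ((X - C (diag L n)) * op L n).Monic := (monic_X_sub_C _).mul hm
    have h2 : ((X - C (diag L n)) * op L n).natDegree = n + 1 := by
      rw [(monic_X_sub_C _).natDegree_mul hm, natDegree_X_sub_C, hd, add_comm]
    have h3 : (prev L n).degree < ((X - C (diag L n)) * op L n).degree := by
      rw [degree_eq_natDegree h1.ne_zero, h2]
      exact hA.trans (by exact_mod_cast Nat.lt_succ_self n)
    refine ⟨?_, ?_, ?_⟩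
    · rw [op_succ]
      exact h1.sub_of_left h3
    · rw [op_succ, natDegree_eq_of_degree_eq (degree_sub_eq_left_of_degree_lt h3), h2]
    · rw [prev_succ]
      refine (degree_C_mul_le _ _).trans_lt ?_
      rw [degree_eq_natDegree hm.ne_zero, hd]
      exact_mod_cast Nat.lt_succ_self n

theorem op_monic (n : ℕ) : (op L n).Monic := (op_monic_natDegree_prev L n).1

theorem natDegree_op (n : ℕ) : (op L n).natDegree = n := (op_monic_natDegree_prev L n).2.1

theorem degree_prev_lt (n : ℕ) : (prev L n).degree < n := (op_monic_natDegree_prev L n).2.2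

theorem degree_op (n : ℕ) : (op L n).degree = n := by
  rw [degree_eq_natDegree (op_monic L n).ne_zero, natDegree_op]

theorem X_mul_op (n : ℕ) : X * op L n = op L (n + 1) + C (diag L n) * op L n + prev L n := by
  rw [op_succ]; ring

variable {L}

theorem IsPos.nrm_pos (hL : IsPos L) (n : ℕ) : 0 < nrm L n := hL _ (op_monic L n).ne_zero

variable (L) in
/-- A functional that vanishes on `p₀, …, pₙ₋₁` vanishes on all polynomials of degree `< n`. -/
theorem map_eq_zero_of_degree_lt (M : ℝ[X] →ₗ[ℝ] ℝ) (n : ℕ) (hM : ∀ j < n, M (op L j) = 0)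
    (q : ℝ[X]) (hq : q.degree < n) : M q = 0 := by
  induction n generalizing q with
  | zero =>
    have : q = 0 := by
      rw [← degree_eq_bot]
      simpa using hq
    simp [this]
  | succ n ih =>
    have h1 : (q - C (q.coeff n) * op L n).degree < n := by
      rw [degree_lt_iff_coeff_zero]
      intro k hk
      rcases hk.lt_or_eq with h | rfl
      · have h2 : q.coeff k = 0 := (degree_lt_iff_coeff_zero _ _).1 hq k h
        have h3 : (op L n).coeff k = 0 := coeff_eq_zero_of_natDegree_lt (by rwa [natDegree_op])
        simp [h2, h3]
      · have h3 : (op L n).coeff n = 1 := by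
          have := (op_monic L n).coeff_natDegree
          rwa [natDegree_op] at this
        simp [h3]
    have h2 := ih (fun j hj => hM j (hj.trans n.lt_succ_self)) _ h1
    rw [map_sub, map_C_mul, hM n n.lt_succ_self, mul_zero, sub_zero] at h2
    exact h2

/-- Multiplication by X is symmetric for L, so in L(p_{n+1} p_j) it can be moved from p_n onto p_j.
For j < n - 1 every term then vanishes by induction; for j = n - 1 the two remaining terms both
equal h_n and cancel; for j = n the choice of `diag` gives zero. -/
theorem IsPos.orthogonal (hL : IsPos L) (n : ℕ) : ∀ j < n, L (op L n * op L j) = 0 := by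
  have hne : ∀ n, nrm L n ≠ 0 := fun n => (hL.nrm_pos n).ne'
  induction n using Nat.strong_induction_on with
  | _ n ih =>
  rcases n with _ | n
  · intro j hj; omega
  have hort : ∀ i j, i ≤ n → j ≤ n → i ≠ j → L (op L i * op L j) = 0 := by
    intro i j hi hj hij
    rcases lt_or_gt_of_ne hij with h | h
    · rw [mul_comm]; exact ih j (by omega) i h
    · exact ih i (by omega) j h
  intro j hj
  -- The truncated k - 1 is harmless at k = 0, where `prev` vanishes.
  have hprev : ∀ i k, i ≤ n → k ≤ n → i ≠ k - 1 → L (prev L k * op L i) = 0 := by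
    intro i k hi hk hik
    rcases k with _ | k
    · simp [prev_zero]
    · rw [prev_succ, mul_assoc, map_C_mul, hort k i (by omega) hi (by simpa using hik.symm),
        mul_zero]
  rcases (Nat.lt_succ_iff.1 hj).lt_or_eq with h | rfl
  · have e : op L (n + 1) * op L j = op L n * op L (j + 1) + C (diag L j) * (op L n * op L j)
        + prev L j * op L n - C (diag L n) * (op L n * op L j) - prev L n * op L j := by
      have := X_mul_op L j
      rw [op_succ]
      linear_combination (op L n) * this
    rw [e, map_sub, map_sub, map_add, map_add, map_C_mul, map_C_mul,
      hort n j le_rfl h.le h.ne', hprev n j le_rfl h.le (by omega)]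
    rcases (Nat.succ_le_of_lt h).lt_or_eq with h' | h'
    · rw [hort n (j + 1) le_rfl h'.le (by omega), hprev j n h.le le_rfl (by omega)]
      ring
    · obtain rfl : j + 1 = n := h'
      have := hne j
      rw [prev_succ, mul_assoc, map_C_mul, ← nrm, ← nrm]
      field_simp
      ring
  · rcases j with _ | j
    · rw [op_succ, prev_zero, sub_zero, sub_mul, sub_mul, map_sub, mul_assoc (C _), map_C_mul,
        ← nrm, diag, div_mul_cancel₀ _ (hne 0), sub_self]
    · rw [op_succ, sub_mul, sub_mul, sub_mul, map_sub, map_sub, mul_assoc (C _), map_C_mul,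
        ← nrm, diag, div_mul_cancel₀ _ (hne _), sub_self,
        hprev (j + 1) (j + 1) le_rfl le_rfl (by omega), sub_zero]

theorem IsPos.map_op_mul_eq_zero (hL : IsPos L) (n : ℕ) (q : ℝ[X]) (hq : q.degree < n) :
    L (op L n * q) = 0 :=
  map_eq_zero_of_degree_lt L (L ∘ₗ LinearMap.mulLeft ℝ (op L n)) n
    (fun j hj => by simpa using hL.orthogonal n j hj) q hq

/-- A polynomial of degree `< n` is determined by its pairings with `p₀, …, pₙ₋₁`. -/
theorem IsPos.ext_of_degree_lt (hL : IsPos L) (n : ℕ) (q r : ℝ[X]) (hq : q.degree < n)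
    (hr : r.degree < n) (h : ∀ j < n, L (q * op L j) = L (r * op L j)) : q = r := by
  have hd : (q - r).degree < n := (degree_sub_le _ _).trans_lt (max_lt hq hr)
  have h0 := map_eq_zero_of_degree_lt L (L ∘ₗ LinearMap.mulLeft ℝ (q - r)) n
    (fun j hj => by
      rw [LinearMap.comp_apply, LinearMap.mulLeft_apply, sub_mul, map_sub, h j hj, sub_self]) _ hd
  by_contra hne
  exact (hL (q - r) (sub_ne_zero.2 hne)).ne' (by simpa using h0)

/-- Thus `prev L n` is the orthogonal projection of X p_n to degree < n; this identifies the Toda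
derivative of p_n. -/
theorem IsPos.map_X_mul_op_mul_op (hL : IsPos L) (n : ℕ) (j : ℕ) (hj : j < n) :
    L (X * (op L n * op L j)) = L (prev L n * op L j) := by
  rw [← mul_assoc, X_mul_op, add_mul, add_mul, map_add, map_add, mul_assoc (C _), map_C_mul,
    hL.orthogonal n j hj, hL.orthogonal (n + 1) j (by omega)]
  ring

theorem degree_ker_lt (n : ℕ) (y : ℝ) : (ker L n y).degree < n := by
  rw [ker, ← mem_degreeLT]
  refine Submodule.sum_mem _ fun j hj => ?_
  rw [mem_degreeLT]
  refine (degree_C_mul_le _ _).trans_lt ?_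
  rw [degree_op]
  exact_mod_cast Finset.mem_range.1 hj

theorem IsPos.map_ker_mul_op (hL : IsPos L) (n : ℕ) (y : ℝ) (j : ℕ) (hj : j < n) :
    L (ker L n y * op L j) = (op L j).eval y := by
  rw [ker, Finset.sum_mul, map_sum, Finset.sum_eq_single_of_mem j (Finset.mem_range.2 hj)]
  · rw [mul_assoc, map_C_mul, ← nrm, div_mul_cancel₀ _ (hL.nrm_pos j).ne']
  · intro i _ hij
    rw [mul_assoc, map_C_mul]
    rcases lt_or_gt_of_ne hij with h | h
    · rw [mul_comm (op L i), hL.orthogonal j i h, mul_zero]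
    · rw [hL.orthogonal i j h, mul_zero]

theorem ker_succ (n : ℕ) (y : ℝ) :
    ker L (n + 1) y = ker L n y + C ((op L n).eval y / nrm L n) * op L n := by
  rw [ker, Finset.sum_range_succ, ← ker]

/-- The confluent Christoffel–Darboux formula. -/
theorem IsPos.christoffel_darboux (hL : IsPos L) (n : ℕ) (y : ℝ) :
    (op L n).eval y * (derivative (prev L n)).eval y
      - (derivative (op L n)).eval y * (prev L n).eval y
      = - nrm L n * (ker L n y).eval y := by
  induction n with
  | zero => simp [prev_zero, ker]
  | succ n ih =>
    have h := (hL.nrm_pos n).ne'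
    rw [prev_succ, ker_succ, op_succ]
    simp only [eval_add, eval_sub, eval_mul, eval_C, eval_X, derivative_sub, derivative_mul,
      derivative_X, derivative_C, eval_zero, eval_one]
    field_simp
    linear_combination (nrm L (n + 1)) * ih

end algebra

/-! ### Differentiable families of polynomials -/

/-- Coefficientwise differentiability of a family of polynomials of bounded degree. -/
def HasPolyDerivAt (q : ℝ → ℝ[X]) (q' : ℝ[X]) (s : ℝ) : Prop :=
  ∃ N, (∀ r, (q r).natDegree < N) ∧ q'.natDegree < N ∧
    ∀ k, HasDerivAt (fun r => (q r).coeff k) (q'.coeff k) s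

namespace HasPolyDerivAt

variable {q r : ℝ → ℝ[X]} {q' r' : ℝ[X]} {s : ℝ}

theorem const (p : ℝ[X]) (s : ℝ) : HasPolyDerivAt (fun _ => p) 0 s :=
  ⟨p.natDegree + 1, fun _ => Nat.lt_succ_self _, by simp, fun k => by
    simpa using hasDerivAt_const s (p.coeff k)⟩

theorem C {f : ℝ → ℝ} {f' : ℝ} (hf : HasDerivAt f f' s) :
    HasPolyDerivAt (fun r => Polynomial.C (f r)) (Polynomial.C f') s :=
  ⟨1, fun _ => by simp, by simp, fun k => by
    simp only [coeff_C]
    split_ifs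
    · exact hf
    · exact hasDerivAt_const _ _⟩

theorem sub (hq : HasPolyDerivAt q q' s) (hr : HasPolyDerivAt r r' s) :
    HasPolyDerivAt (fun u => q u - r u) (q' - r') s := by
  obtain ⟨N, h1, h2, h3⟩ := hq
  obtain ⟨M, k1, k2, k3⟩ := hr
  refine ⟨max N M, fun u => (natDegree_sub_le _ _).trans_lt (max_lt_max (h1 u) (k1 u)),
    (natDegree_sub_le _ _).trans_lt (max_lt_max h2 k2), fun k => ?_⟩
  simpa only [coeff_sub] using (h3 k).fun_sub (k3 k)

theorem mul (hq : HasPolyDerivAt q q' s) (hr : HasPolyDerivAt r r' s) :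
    HasPolyDerivAt (fun u => q u * r u) (q' * r s + q s * r') s := by
  obtain ⟨N, h1, h2, h3⟩ := hq
  obtain ⟨M, k1, k2, k3⟩ := hr
  refine ⟨N + M, fun u => natDegree_mul_le.trans_lt (by have := h1 u; have := k1 u; omega),
    (natDegree_add_le _ _).trans_lt (max_lt ?_ ?_), fun k => ?_⟩
  · exact natDegree_mul_le.trans_lt (by have := k1 s; omega)
  · exact natDegree_mul_le.trans_lt (by have := h1 s; omega)
  · simp only [coeff_mul, coeff_add, ← Finset.sum_add_distrib]
    exact HasDerivAt.fun_sum fun i _ => (h3 i.1).mul (k3 i.2)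

theorem derivative (hq : HasPolyDerivAt q q' s) :
    HasPolyDerivAt (fun u => Polynomial.derivative (q u)) (Polynomial.derivative q') s := by
  obtain ⟨N, h1, h2, h3⟩ := hq
  refine ⟨N, fun u => ((natDegree_derivative_le _).trans (Nat.sub_le _ _)).trans_lt (h1 u),
    ((natDegree_derivative_le _).trans (Nat.sub_le _ _)).trans_lt h2, fun k => ?_⟩
  simp only [coeff_derivative]
  exact (h3 _).mul_const _

theorem eval (hq : HasPolyDerivAt q q' s) {f : ℝ → ℝ} {f' : ℝ} (hf : HasDerivAt f f' s) :
    HasDerivAt (fun u => (q u).eval (f u))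
      (q'.eval (f s) + (Polynomial.derivative (q s)).eval (f s) * f') s := by
  obtain ⟨N, h1, h2, h3⟩ := hq
  have e : (fun u => (q u).eval (f u)) =
      fun u => ∑ k ∈ Finset.range N, (q u).coeff k * f u ^ k := by
    funext u
    exact eval_eq_sum_range' (h1 u) _
  have e1 : (Polynomial.derivative (q s)).eval (f s) =
      ∑ k ∈ Finset.range N, (q s).coeff k * (k * f s ^ (k - 1)) := by
    conv_lhs => rw [(q s).as_sum_range' N (h1 s)]
    simp [derivative_monomial, eval_finsetSum, mul_assoc]
  rw [e, e1, eval_eq_sum_range' h2, Finset.sum_mul, ← Finset.sum_add_distrib]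
  refine HasDerivAt.fun_sum fun k _ => ?_
  refine ((h3 k).fun_mul (hf.fun_pow k)).congr_deriv ?_
  ring

theorem eval_const (hq : HasPolyDerivAt q q' s) (y : ℝ) :
    HasDerivAt (fun u => (q u).eval y) (q'.eval y) s := by
  simpa using hq.eval (hasDerivAt_const s y)

/-- The uniform degree bound makes `L u (q u)` a fixed finite sum of products of a coefficient and a
moment, to which the product rule applies. -/
theorem map {L : ℝ → ℝ[X] →ₗ[ℝ] ℝ} {L' : ℝ[X] →ₗ[ℝ] ℝ}
    (hL : ∀ p, HasDerivAt (fun u => L u p) (L' p) s) (hq : HasPolyDerivAt q q' s) :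
    HasDerivAt (fun u => L u (q u)) (L s q' + L' (q s)) s := by
  obtain ⟨N, h1, h2, h3⟩ := hq
  have e : ∀ (M : ℝ[X] →ₗ[ℝ] ℝ) (p : ℝ[X]), p.natDegree < N →
      M p = ∑ k ∈ Finset.range N, p.coeff k * M (X ^ k) := by
    intro M p hp
    conv_lhs => rw [p.as_sum_range' N hp]
    rw [map_sum]
    refine Finset.sum_congr rfl fun k _ => ?_
    rw [← C_mul_X_pow_eq_monomial, map_C_mul]
  have e1 : (fun u => L u (q u)) =
      fun u => ∑ k ∈ Finset.range N, (q u).coeff k * L u (X ^ k) := by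
    funext u
    exact e _ _ (h1 u)
  rw [e1, e _ _ h2, e _ _ (h1 s), ← Finset.sum_add_distrib]
  exact HasDerivAt.fun_sum fun k _ => (h3 k).fun_mul (hL _)

end HasPolyDerivAt

/-! ### Variation of orthogonal polynomials with the functional -/

section deformation

variable {L : ℝ → ℝ[X] →ₗ[ℝ] ℝ} {L' : ℝ[X] →ₗ[ℝ] ℝ} {s : ℝ}

/-- The recurrence uses only moments, products and quotients by nonzero norms, so differentiability
passes along it. The derivative is left implicit here; orthogonality identifies it afterwards. -/
theorem exists_hasPolyDerivAt (hL : ∀ p, HasDerivAt (fun u => L u p) (L' p) s)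
    (hpos : IsPos (L s)) (n : ℕ) :
    (∃ p', HasPolyDerivAt (fun u => op (L u) n) p' s) ∧
    ∃ q', HasPolyDerivAt (fun u => prev (L u) n) q' s := by
  induction n with
  | zero => exact ⟨⟨0, .const 1 s⟩, ⟨0, .const 0 s⟩⟩
  | succ n ih =>
    obtain ⟨⟨p', hp⟩, ⟨q', hq⟩⟩ := ih
    have hX : HasPolyDerivAt (fun _ => X) 0 s := .const X s
    have hn := (hp.mul hp).map hL
    have hd := ((hX.mul hp).mul hp).map hL |>.fun_div hn (hpos.nrm_pos n).ne'
    have hp1 := ((hX.sub (.C hd)).mul hp).sub hq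
    have hn1 := ((hp1.mul hp1).map hL).fun_div hn (hpos.nrm_pos n).ne'
    exact ⟨⟨_, hp1⟩, ⟨_, (HasPolyDerivAt.C hn1).mul hp⟩⟩

/-- The leading coefficient is constantly 1. -/
theorem HasPolyDerivAt.degree_op_lt {n : ℕ} {p' : ℝ[X]}
    (h : HasPolyDerivAt (fun u => op (L u) n) p' s) : p'.degree < n := by
  obtain ⟨N, -, -, h3⟩ := h
  rw [degree_lt_iff_coeff_zero]
  intro k hk
  have e : (fun u => (op (L u) n).coeff k) = fun _ => if k = n then (1 : ℝ) else 0 := by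
    funext u
    split_ifs with hkn
    · subst hkn
      have := (op_monic (L u) k).coeff_natDegree
      rwa [natDegree_op] at this
    · exact coeff_eq_zero_of_natDegree_lt (by rw [natDegree_op]; omega)
  have := h3 k
  rw [e] at this
  exact this.unique (hasDerivAt_const _ _)

/-- The variation of the orthogonal polynomials under a variation of the functional. -/
theorem hasPolyDerivAt_op (hL : ∀ p, HasDerivAt (fun u => L u p) (L' p) s)
    (hpos : ∀ᶠ u in 𝓝 s, IsPos (L u)) (n : ℕ) (r : ℝ[X]) (hr : r.degree < n)
    (h : ∀ j < n, L s (r * op (L s) j) = - L' (op (L s) n * op (L s) j)) :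
    HasPolyDerivAt (fun u => op (L u) n) r s := by
  have hs := hpos.self_of_nhds
  obtain ⟨p', hp⟩ := (exists_hasPolyDerivAt hL hs n).1
  have hd := hp.degree_op_lt
  suffices p' = r by rwa [← this]
  refine hs.ext_of_degree_lt n _ _ hd hr fun j hj => ?_
  obtain ⟨q', hq⟩ := (exists_hasPolyDerivAt hL hs j).1
  -- Differentiate L(p_n p_j) = 0. The term with the derivative of p_j drops out because its degree
  -- is below n, so the pairings of p' with all p_j, j < n, are known, and they determine p'.
  have h0 : HasDerivAt (fun u => L u (op (L u) n * op (L u) j)) 0 s := by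
    refine (hasDerivAt_const s (0 : ℝ)).congr_of_eventuallyEq ?_
    filter_upwards [hpos] with u hu using hu.orthogonal n j hj
  have h1 := ((hp.mul hq).map hL).unique h0
  have h2 : L s (op (L s) n * q') = 0 :=
    hs.map_op_mul_eq_zero n q' (hq.degree_op_lt.trans (by exact_mod_cast hj))
  rw [map_add, h2] at h1
  rw [h j hj]
  linarith

/-- The variation of the squared norms under a variation of the functional. -/
theorem hasDerivAt_nrm (hL : ∀ p, HasDerivAt (fun u => L u p) (L' p) s)
    (hpos : IsPos (L s)) (n : ℕ) :
    HasDerivAt (fun u => nrm (L u) n) (L' (op (L s) n * op (L s) n)) s := by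
  obtain ⟨p', hp⟩ := (exists_hasPolyDerivAt hL hpos n).1
  have h1 := (hp.mul hp).map hL
  have h2 := hpos.map_op_mul_eq_zero n p' hp.degree_op_lt
  rw [map_add, mul_comm p', h2, add_zero, zero_add] at h1
  exact h1

theorem differentiableAt_diag (hL : ∀ p, HasDerivAt (fun u => L u p) (L' p) s)
    (hpos : IsPos (L s)) (n : ℕ) : DifferentiableAt ℝ (fun u => diag (L u) n) s := by
  obtain ⟨p', hp⟩ := (exists_hasPolyDerivAt hL hpos n).1
  have hX : HasPolyDerivAt (fun _ => X) 0 s := .const X s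
  exact (((hX.mul hp).mul hp).map hL |>.fun_div (hasDerivAt_nrm hL hpos n)
    (hpos.nrm_pos n).ne').differentiableAt

end deformation

/-! ### Elimination: from the first-order system to the PDE -/

/-- The partial derivatives of `T` and the differential equation, from the first-order system in
`t` satisfied by `E = ± w(ξ) / hₙ`, `P = pₙ(ξ)`, `D = pₙ'(ξ)`, `A = (hₙ / hₙ₋₁) pₙ₋₁(ξ)`,
`B = (hₙ / hₙ₋₁) pₙ₋₁'(ξ)` and `S = ± w(ξ) Kₙ(ξ, ξ)`. -/
theorem pde_of_system {T : ℝ → ℝ → ℝ} {ξ t v : ℝ} {E P D A B b S : ℝ → ℝ}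
    (hE : ∀ᶠ s in 𝓝 t, HasDerivAt E ((ξ - b s) * E s) s)
    (hP : ∀ᶠ s in 𝓝 t, HasDerivAt P (-A s) s)
    (hD : ∀ᶠ s in 𝓝 t, HasDerivAt D (-B s) s)
    (hS : ∀ᶠ s in 𝓝 t, HasDerivAt S (E s * A s * P s) s)
    (hA : DifferentiableAt ℝ A t) (hB : DifferentiableAt ℝ B t) (hb : DifferentiableAt ℝ b t)
    (hCD : ∀ᶠ s in 𝓝 t, E s * (A s * D s - P s * B s) = S s)
    (hTt : ∀ᶠ s in 𝓝 t, HasDerivAt (fun s => T ξ s) (b s) s)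
    (hTx : ∀ᶠ s in 𝓝 t, dXi T ξ s = E s * P s ^ 2)
    (hTxx : ∀ᶠ s in 𝓝 t, dXi (dXi T) ξ s =
      (s - v) * (E s * P s ^ 2) + 2 * E s * P s * (D s - S s * P s) - (E s * P s ^ 2) ^ 2) :
    DifferentiableAt ℝ (fun s => T ξ s) t ∧
    DifferentiableAt ℝ (fun s => dT T ξ s) t ∧
    DifferentiableAt ℝ (fun s => dXi T ξ s) t ∧
    DifferentiableAt ℝ (fun s => dT (dXi T) ξ s) t ∧
    DifferentiableAt ℝ (fun s => dXi (dXi T) ξ s) t ∧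
    DifferentiableAt ℝ (fun s => dT (dXi (dXi T)) ξ s) t ∧
    (dXi T ξ t ≠ 0 →
      dT (dT (dXi (dXi T))) ξ t
        - dT (dT (dXi T)) ξ t * dXi (dXi T) ξ t / dXi T ξ t
        - (dXi T ξ t) ^ 2 * dT (dT T) ξ t
        - dT (dXi T) ξ t * dT (dXi (dXi T)) ξ t / dXi T ξ t
        + (dT (dXi T) ξ t) ^ 2 * dXi (dXi T) ξ t / (dXi T ξ t) ^ 2
        + (ξ - dT T ξ t) * dXi T ξ t * (2 * dT (dXi T) ξ t - 1) = 0) := by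
  set R : ℝ → ℝ := fun s => E s * P s ^ 2 with hRdef
  set R1 : ℝ → ℝ := fun s => E s * P s * ((ξ - b s) * P s - 2 * A s) with hR1def
  set Q : ℝ → ℝ := fun s =>
    (s - v) * R s + 2 * E s * P s * (D s - S s * P s) - R s ^ 2 with hQdef
  set Q1 : ℝ → ℝ := fun s => R s + (s - v) * R1 s
    + 2 * ((ξ - b s) * E s * P s * (D s - S s * P s) - E s * A s * (D s - S s * P s)
      + E s * P s * (-B s - E s * A s * P s ^ 2 + S s * A s)) - 2 * R s * R1 s with hQ1def
  have hR : ∀ᶠ s in 𝓝 t, HasDerivAt R (R1 s) s := by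
    filter_upwards [hE, hP] with s h1 h2
    refine (h1.fun_mul (h2.fun_pow 2)).congr_deriv ?_
    simp only [hR1def]
    push_cast
    ring
  have hQ : ∀ᶠ s in 𝓝 t, HasDerivAt Q (Q1 s) s := by
    filter_upwards [hR, hE, hP, hD, hS] with s h0 h1 h2 h3 h4
    refine (((((hasDerivAt_id' s).sub_const v).fun_mul h0).fun_add
      (((h1.const_mul 2).fun_mul h2).fun_mul (h3.fun_sub (h4.fun_mul h2)))).fun_sub
      (h0.fun_pow 2)).congr_deriv ?_
    simp only [hQ1def]
    push_cast
    ring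
  have dE := hE.self_of_nhds.differentiableAt
  have dP := hP.self_of_nhds.differentiableAt
  have dD := hD.self_of_nhds.differentiableAt
  have dS := hS.self_of_nhds.differentiableAt
  have dR := hR.self_of_nhds.differentiableAt
  have dR1 : DifferentiableAt ℝ R1 t := by simp only [hR1def]; fun_prop
  have dQ1 : DifferentiableAt ℝ Q1 t := by simp only [hQ1def]; fun_prop
  have deriv_congr : ∀ {f g g' : ℝ → ℝ}, f =ᶠ[𝓝 t] g → (∀ᶠ s in 𝓝 t, HasDerivAt g (g' s) s) →
      (fun s => deriv f s) =ᶠ[𝓝 t] g' := by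
    intro f g g' hfg hg
    filter_upwards [hfg.eventually_nhds, hg] with s h1 h2
    rw [Filter.EventuallyEq.deriv_eq h1, h2.deriv]
  have eTt : (fun s => dT T ξ s) =ᶠ[𝓝 t] b := deriv_congr (EventuallyEq.refl _ _) hTt
  have eR : (fun s => dXi T ξ s) =ᶠ[𝓝 t] R := hTx
  have eQ : (fun s => dXi (dXi T) ξ s) =ᶠ[𝓝 t] Q := hTxx
  have eR1 : (fun s => dT (dXi T) ξ s) =ᶠ[𝓝 t] R1 := deriv_congr eR hR
  have eQ1 : (fun s => dT (dXi (dXi T)) ξ s) =ᶠ[𝓝 t] Q1 := deriv_congr eQ hQ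
  refine ⟨hTt.self_of_nhds.differentiableAt, hb.congr_of_eventuallyEq eTt,
    dR.congr_of_eventuallyEq eR, dR1.congr_of_eventuallyEq eR1,
    hQ.self_of_nhds.differentiableAt.congr_of_eventuallyEq eQ, dQ1.congr_of_eventuallyEq eQ1, ?_⟩
  have eT2 : dT (dT T) ξ t = deriv b t := eTt.deriv_eq
  have eR2 : dT (dT (dXi T)) ξ t = deriv R1 t := eR1.deriv_eq
  have eQ2 : dT (dT (dXi (dXi T))) ξ t = deriv Q1 t := eQ1.deriv_eq
  have e1 : dT T ξ t = b t := eTt.self_of_nhds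
  have e2 : dXi T ξ t = R t := eR.self_of_nhds
  have e3 : dXi (dXi T) ξ t = Q t := eQ.self_of_nhds
  have e4 : dT (dXi T) ξ t = R1 t := eR1.self_of_nhds
  have e5 : dT (dXi (dXi T)) ξ t = Q1 t := eQ1.self_of_nhds
  rw [eT2, eR2, eQ2, e1, e2, e3, e4, e5]
  intro hne
  -- The Christoffel–Darboux relation removes D and B, leaving S as the only quantity not expressed
  -- by derivatives of T.
  have hQ1 : Q1 =ᶠ[𝓝 t] fun s =>
      R1 s * Q s / R s + 2 * S s + R s - (ξ - b s) * R s ^ 2 := by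
    filter_upwards [dR.continuousAt.eventually_ne hne, hCD] with s hs h
    rw [div_add' _ _ _ hs, div_add' _ _ _ hs, div_sub' hs, eq_div_iff hs]
    simp only [hQ1def, hQdef, hR1def, hRdef]
    linear_combination (2 * (E s * P s ^ 2)) * h
  have key : deriv Q1 t = _ := hQ1.deriv_eq.trans
    ((((((dR1.hasDerivAt.fun_mul hQ.self_of_nhds).fun_div hR.self_of_nhds hne).fun_add
      (hS.self_of_nhds.const_mul 2)).fun_add hR.self_of_nhds).fun_sub
      ((hb.hasDerivAt.const_sub ξ).fun_mul (hR.self_of_nhds.fun_pow 2))).deriv)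
  -- The left side is 2S_t, so S disappears after this differentiation.
  have h2S : 2 * (E t * A t * P t) = R t * (ξ - b t) - R1 t := by
    simp only [hR1def, hRdef]; ring
  rw [key, h2S]
  field_simp
  push_cast
  ring

/-! ### The Toda flow and the moving endpoint -/

section twoParameter

variable {L : ℝ → ℝ → ℝ[X] →ₗ[ℝ] ℝ} {U N : Set ℝ} {e : ℝ → ℝ → ℝ}

section t

variable {L : ℝ → ℝ[X] →ₗ[ℝ] ℝ} {s : ℝ} (hN : N ∈ 𝓝 s) (hpos : ∀ u ∈ N, IsPos (L u))
  (ht : ∀ q, HasDerivAt (fun u => L u q) (L s (X * q)) s)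
include hN hpos ht

theorem hasPolyDerivAt_op_toda (n : ℕ) :
    HasPolyDerivAt (fun u => op (L u) n) (-prev (L s) n) s := by
  refine hasPolyDerivAt_op ht (L' := L s ∘ₗ LinearMap.mulLeft ℝ X)
    (eventually_of_mem hN hpos) n _ (by rw [degree_neg]; exact degree_prev_lt _ _) fun j hj => ?_
  rw [neg_mul, map_neg, LinearMap.comp_apply, LinearMap.mulLeft_apply,
    (hpos s (mem_of_mem_nhds hN)).map_X_mul_op_mul_op n j hj]

theorem hasDerivAt_nrm_toda (n : ℕ) :
    HasDerivAt (fun u => nrm (L u) n) (diag (L s) n * nrm (L s) n) s := by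
  have hp := hpos s (mem_of_mem_nhds hN)
  refine (hasDerivAt_nrm (L' := L s ∘ₗ LinearMap.mulLeft ℝ X) ht hp n).congr_deriv ?_
  rw [diag, div_mul_cancel₀ _ (hp.nrm_pos n).ne', LinearMap.comp_apply,
    LinearMap.mulLeft_apply, mul_assoc]

/-- The derivative of e p_n(y)²/h_n is (e/h_n) p_n(y) (p_{n+1}(y) - `prev`_n(y)) by the recurrence.
This is the difference of the right-hand sides for n + 1 and n, so the sum telescopes. -/
theorem hasDerivAt_ker_toda {e : ℝ → ℝ} {y : ℝ} (he : HasDerivAt e (y * e s) s) (n : ℕ) :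
    HasDerivAt (fun u => e u * (ker (L u) n y).eval y)
      (e s / nrm (L s) n * (prev (L s) n).eval y * (op (L s) n).eval y) s := by
  have hp := hpos s (mem_of_mem_nhds hN)
  induction n with
  | zero => simpa [ker, prev_zero] using hasDerivAt_const s (0 : ℝ)
  | succ n ih =>
    have h0 := (hp.nrm_pos n).ne'
    have h1 := (hp.nrm_pos (n + 1)).ne'
    have hP := (hasPolyDerivAt_op_toda hN hpos ht n).eval_const y
    have hh := hasDerivAt_nrm_toda hN hpos ht n
    have h2 := ih.fun_add (he.fun_mul ((hP.fun_div hh h0).fun_mul hP))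
    have e1 : (fun u => e u * (ker (L u) (n + 1) y).eval y) = fun u =>
        e u * (ker (L u) n y).eval y +
          e u * ((op (L u) n).eval y / nrm (L u) n * (op (L u) n).eval y) := by
      funext u
      rw [ker_succ]
      simp only [eval_add, eval_mul, eval_C]
      ring
    rw [e1]
    refine h2.congr_deriv ?_
    rw [prev_succ, op_succ]
    simp only [eval_sub, eval_mul, eval_C, eval_X, eval_neg]
    field_simp
    ring

end t

section endpoint

variable {L : ℝ → ℝ[X] →ₗ[ℝ] ℝ} {x c : ℝ} (hU : U ∈ 𝓝 x) (hpos : ∀ y ∈ U, IsPos (L y))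
  (hx : ∀ q : ℝ[X], HasDerivAt (fun y => L y q) (c * q.eval x) x)
include hU hpos hx

/-- Here L' is c times evaluation at x, so the required pairings with p_j are -c p_n(x) p_j(x),
which the reproducing property of the kernel realizes. -/
theorem hasPolyDerivAt_op_endpoint (n : ℕ) :
    HasPolyDerivAt (fun y => op (L y) n) (-(C (c * (op (L x) n).eval x) * ker (L x) n x)) x := by
  refine hasPolyDerivAt_op (L' := c • leval x) (fun q => by simpa using hx q)
    (eventually_of_mem hU hpos) n _ ?_ fun j hj => ?_
  · rw [degree_neg]
    exact (degree_C_mul_le _ _).trans_lt (degree_ker_lt _ _)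
  · rw [neg_mul, map_neg, mul_assoc, map_C_mul,
      (hpos x (mem_of_mem_nhds hU)).map_ker_mul_op n x j hj]
    simp [mul_assoc]

theorem hasDerivAt_nrm_endpoint (n : ℕ) :
    HasDerivAt (fun y => nrm (L y) n) (c * (op (L x) n).eval x ^ 2) x := by
  refine (hasDerivAt_nrm (L' := c • leval x) (fun q => by simpa using hx q)
    (hpos x (mem_of_mem_nhds hU)) n).congr_deriv ?_
  simp [sq]

end endpoint

/-- The differential equation for the logarithm of a squared norm of the orthogonal polynomials of
functionals `L x s` that depend on `x` as on an endpoint and on `s` as on the first Toda time. -/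
theorem pde_of_functional {T : ℝ → ℝ → ℝ} {V : ℝ → ℝ} {ε ξ t : ℝ} (n : ℕ)
    (hU : U ∈ 𝓝 ξ) (hN : N ∈ 𝓝 t) (hUo : IsOpen U) (hNo : IsOpen N)
    (hV : DifferentiableAt ℝ V ξ)
    (hpos : ∀ x ∈ U, ∀ s ∈ N, IsPos (L x s))
    (ht : ∀ x ∈ U, ∀ s ∈ N, ∀ q, HasDerivAt (fun u => L x u q) (L x s (X * q)) s)
    (hx : ∀ x ∈ U, ∀ s ∈ N, ∀ q : ℝ[X], HasDerivAt (fun y => L y s q)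
      (ε * todaWeight V s x * q.eval x) x)
    (hT : ∀ x ∈ U, ∀ s ∈ N, T x s = Real.log (nrm (L x s) n)) :
    DifferentiableAt ℝ (fun x => T x t) ξ ∧
    DifferentiableAt ℝ (fun x => dXi T x t) ξ ∧
    DifferentiableAt ℝ (fun s => T ξ s) t ∧
    DifferentiableAt ℝ (fun s => dT T ξ s) t ∧
    DifferentiableAt ℝ (fun s => dXi T ξ s) t ∧
    DifferentiableAt ℝ (fun s => dT (dXi T) ξ s) t ∧
    DifferentiableAt ℝ (fun s => dXi (dXi T) ξ s) t ∧
    DifferentiableAt ℝ (fun s => dT (dXi (dXi T)) ξ s) t ∧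
    (dXi T ξ t ≠ 0 →
      dT (dT (dXi (dXi T))) ξ t
        - dT (dT (dXi T)) ξ t * dXi (dXi T) ξ t / dXi T ξ t
        - (dXi T ξ t) ^ 2 * dT (dT T) ξ t
        - dT (dXi T) ξ t * dT (dXi (dXi T)) ξ t / dXi T ξ t
        + (dT (dXi T) ξ t) ^ 2 * dXi (dXi T) ξ t / (dXi T ξ t) ^ 2
        + (ξ - dT T ξ t) * dXi T ξ t * (2 * dT (dXi T) ξ t - 1) = 0) := by
  have hUn : ∀ x ∈ U, U ∈ 𝓝 x := fun x hx => hUo.mem_nhds hx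
  have hNn : ∀ s ∈ N, N ∈ 𝓝 s := fun s hs => hNo.mem_nhds hs
  have hξ : ξ ∈ U := mem_of_mem_nhds hU
  have htN : t ∈ N := mem_of_mem_nhds hN
  have hposx : ∀ s ∈ N, ∀ x ∈ U, IsPos (L x s) := fun s hs x hx => hpos x hx s hs
  have hTx : ∀ x ∈ U, ∀ s ∈ N, HasDerivAt (fun y => T y s)
      (ε * todaWeight V s x / nrm (L x s) n * (op (L x s) n).eval x ^ 2) x := by
    intro x hxU s hs
    have h := (hasDerivAt_nrm_endpoint (hUn x hxU) (hposx s hs) (hx x hxU s hs) n).log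
      ((hpos x hxU s hs).nrm_pos n).ne'
    refine (h.congr_of_eventuallyEq ?_).congr_deriv (by ring)
    filter_upwards [hUn x hxU] with y hy using hT y hy s hs
  have hTt : ∀ s ∈ N, HasDerivAt (fun u => T ξ u) (diag (L ξ s) n) s := by
    intro s hs
    have h0 := ((hpos ξ hξ s hs).nrm_pos n).ne'
    have h := (hasDerivAt_nrm_toda (hNn s hs) (hpos ξ hξ) (ht ξ hξ s hs) n).log h0
    refine (h.congr_of_eventuallyEq ?_).congr_deriv (by field_simp)
    filter_upwards [hNn s hs] with u hu using hT ξ hξ u hu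
  have hTxx : ∀ s ∈ N, HasDerivAt (fun y => dXi T y s)
      ((s - deriv V ξ) * (ε * todaWeight V s ξ / nrm (L ξ s) n * (op (L ξ s) n).eval ξ ^ 2)
        + 2 * (ε * todaWeight V s ξ / nrm (L ξ s) n) * (op (L ξ s) n).eval ξ *
          ((derivative (op (L ξ s) n)).eval ξ
            - ε * todaWeight V s ξ * (ker (L ξ s) n ξ).eval ξ * (op (L ξ s) n).eval ξ)
        - (ε * todaWeight V s ξ / nrm (L ξ s) n * (op (L ξ s) n).eval ξ ^ 2) ^ 2) ξ := by
    intro s hs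
    have h0 := ((hpos ξ hξ s hs).nrm_pos n).ne'
    have hw : HasDerivAt (fun y => todaWeight V s y)
        ((s - deriv V ξ) * todaWeight V s ξ) ξ := by
      refine ((hV.hasDerivAt.fun_neg.fun_add ((hasDerivAt_id' ξ).const_mul s)).exp).congr_deriv ?_
      rw [todaWeight]
      ring
    have hh := hasDerivAt_nrm_endpoint hU (hposx s hs) (hx ξ hξ s hs) n
    -- Both the polynomial and its evaluation point move: the first motion gives the kernel term,
    -- the second p_n'(ξ).
    have hP := (hasPolyDerivAt_op_endpoint hU (hposx s hs) (hx ξ hξ s hs) n).eval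
      (hasDerivAt_id' ξ)
    have h := ((hw.const_mul ε).fun_div hh h0).fun_mul (hP.fun_pow 2)
    refine (h.congr_of_eventuallyEq ?_).congr_deriv ?_
    · filter_upwards [hU] with y hy using (hTx y hy s hs).deriv
    · simp only [eval_neg, eval_mul, eval_C]
      push_cast
      field_simp
      ring
  refine ⟨(hTx ξ hξ t htN).differentiableAt, (hTxx t htN).differentiableAt, ?_⟩
  have hposξ := hpos ξ hξ
  have hPt : ∀ s ∈ N, HasPolyDerivAt (fun u => op (L ξ u) n) (-prev (L ξ s) n) s :=
    fun s hs => hasPolyDerivAt_op_toda (hNn s hs) hposξ (ht ξ hξ s hs) n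
  have hwt : ∀ s, HasDerivAt (fun u => ε * todaWeight V u ξ)
      (ξ * (ε * todaWeight V s ξ)) s := by
    intro s
    refine (((((hasDerivAt_id' s).mul_const ξ).const_add (-V ξ)).exp).const_mul ε).congr_deriv ?_
    rw [todaWeight]
    ring
  -- Differentiability of A and B at t suffices; the values of their derivatives do not enter the
  -- equation.
  obtain ⟨A', hA'⟩ := (exists_hasPolyDerivAt (L' := L ξ t ∘ₗ LinearMap.mulLeft ℝ X)
    (ht ξ hξ t htN) (hposξ t htN) n).2
  refine pde_of_system (v := deriv V ξ)
    (E := fun s => ε * todaWeight V s ξ / nrm (L ξ s) n)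
    (P := fun s => (op (L ξ s) n).eval ξ) (D := fun s => (derivative (op (L ξ s) n)).eval ξ)
    (A := fun s => (prev (L ξ s) n).eval ξ) (B := fun s => (derivative (prev (L ξ s) n)).eval ξ)
    (b := fun s => diag (L ξ s) n)
    (S := fun s => ε * todaWeight V s ξ * (ker (L ξ s) n ξ).eval ξ)
    ?_ ?_ ?_ ?_ (hA'.eval_const ξ).differentiableAt (hA'.derivative.eval_const ξ).differentiableAt
    (differentiableAt_diag (L' := L ξ t ∘ₗ LinearMap.mulLeft ℝ X) (ht ξ hξ t htN)
      (hposξ t htN) n) ?_ (eventually_of_mem hN hTt)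
    (eventually_of_mem hN fun s hs => (hTx ξ hξ s hs).deriv)
    (eventually_of_mem hN fun s hs => (hTxx s hs).deriv)
  · filter_upwards [hN] with s hs
    have h0 := ((hposξ s hs).nrm_pos n).ne'
    refine ((hwt s).fun_div (hasDerivAt_nrm_toda (hNn s hs) hposξ (ht ξ hξ s hs) n)
      h0).congr_deriv ?_
    field_simp
  · filter_upwards [hN] with s hs
    simpa using (hPt s hs).eval_const ξ
  · filter_upwards [hN] with s hs
    simpa using (hPt s hs).derivative.eval_const ξ
  · filter_upwards [hN] with s hs
    exact hasDerivAt_ker_toda (hNn s hs) hposξ (ht ξ hξ s hs) (hwt s) n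
  · filter_upwards [hN] with s hs
    have h0 := ((hposξ s hs).nrm_pos n).ne'
    have h := (hposξ s hs).christoffel_darboux n ξ
    field_simp
    linear_combination -(ε * todaWeight V s ξ) * h

end twoParameter

/-! ### Moments of the weight and the matrix integral -/

/-- The functional `q ↦ ∫_J q(y) exp (-V(y) + s y) dy`. -/
noncomputable def weightFunctional (V : ℝ → ℝ) (J : Set ℝ) (s : ℝ) : ℝ[X] →ₗ[ℝ] ℝ :=
  Polynomial.lsum fun k => (∫ y in J, y ^ k * todaWeight V s y) • LinearMap.id

/-- The parameters around which the weight is integrable on `J`. -/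
def todaDomain (V : ℝ → ℝ) (J : Set ℝ) : Set ℝ :=
  interior {s | IntegrableOn (fun y => todaWeight V s y) J}

theorem todaWeight_pos (V : ℝ → ℝ) (s y : ℝ) : 0 < todaWeight V s y := Real.exp_pos _

theorem weightFunctional_monomial (V : ℝ → ℝ) (J : Set ℝ) (s : ℝ) (k : ℕ) (c : ℝ) :
    weightFunctional V J s (monomial k c) = c * ∫ y in J, y ^ k * todaWeight V s y := by
  simp [weightFunctional, sum_monomial_index, mul_comm]

theorem hasDerivAt_of_monomial {L : ℝ → ℝ[X] →ₗ[ℝ] ℝ} {L' : ℝ[X] →ₗ[ℝ] ℝ} {s : ℝ}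
    (h : ∀ k, HasDerivAt (fun u => L u (monomial k 1)) (L' (monomial k 1)) s) (q : ℝ[X]) :
    HasDerivAt (fun u => L u q) (L' q) s := by
  induction q using Polynomial.induction_on' with
  | add p q hp hq => simpa only [map_add] using hp.fun_add hq
  | monomial k c =>
    have e : monomial k c = C c * monomial k (1 : ℝ) := by rw [C_mul_monomial, mul_one]
    rw [e]
    simpa only [map_C_mul] using (h k).const_mul c

section moments

variable {V : ℝ → ℝ} {J : Set ℝ} {s : ℝ}

/-- The density `exp (-V)` on `J` turns integrals against the weight into exponential moments. -/
theorem integrable_pow_and_hasDerivAt (hs : s ∈ todaDomain V J) (k : ℕ) :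
    IntegrableOn (fun y => y ^ k * todaWeight V s y) J ∧
    HasDerivAt (fun u => ∫ y in J, y ^ k * todaWeight V u y)
      (∫ y in J, y ^ (k + 1) * todaWeight V s y) s := by
  have hs' : IntegrableOn (fun y => todaWeight V s y) J := by
    have h : s ∈ {s | IntegrableOn (fun y => todaWeight V s y) J} := interior_subset hs
    exact h
  -- No measurability of V is assumed: that of exp(-V) on J is recovered from the integrable weight
  -- by multiplying by exp(-s y).
  have hm : AEMeasurable (fun y => ENNReal.ofReal (Real.exp (-V y))) (volume.restrict J) := by
    refine AEMeasurable.ennreal_ofReal ?_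
    have h := hs'.aestronglyMeasurable.aemeasurable.mul
      ((by fun_prop : Measurable fun y : ℝ => Real.exp (-(s * y))).aemeasurable)
    refine h.congr (Eventually.of_forall fun y => ?_)
    simp only [todaWeight, Pi.mul_apply, ← Real.exp_add]
    congr 1
    ring
  have hfin : ∀ᵐ y ∂(volume.restrict J), ENNReal.ofReal (Real.exp (-V y)) < ⊤ :=
    Eventually.of_forall fun y => ENNReal.ofReal_lt_top
  have e : ∀ (k : ℕ) (u y : ℝ), (ENNReal.ofReal (Real.exp (-V y))).toReal •
      (id y ^ k * Real.exp (u * id y)) = y ^ k * todaWeight V u y := by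
    intro k u y
    rw [ENNReal.toReal_ofReal (Real.exp_pos _).le, todaWeight, Real.exp_add, smul_eq_mul, id]
    ring
  -- With respect to ν the integrals are those of y^k exp(u y), which may be differentiated in the
  -- interior of the domain of the moment generating function of `id`.
  set ν := (volume.restrict J).withDensity fun y => ENNReal.ofReal (Real.exp (-V y)) with hν
  have hset : ProbabilityTheory.integrableExpSet id ν =
      {s | IntegrableOn (fun y => todaWeight V s y) J} := by
    ext u
    rw [ProbabilityTheory.integrableExpSet, mem_ofPred_eq, hν,
      integrable_withDensity_iff_integrable_smul₀' hm hfin, mem_ofPred_eq, IntegrableOn]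
    have := e 0 u
    simp only [pow_zero, one_mul] at this
    simp only [this]
  have hs2 : s ∈ interior (ProbabilityTheory.integrableExpSet id ν) := by rwa [hset]
  have hint : ∀ (k : ℕ) (u : ℝ), ∫ y, id y ^ k * Real.exp (u * id y) ∂ν =
      ∫ y in J, y ^ k * todaWeight V u y := by
    intro k u
    rw [hν, integral_withDensity_eq_integral_toReal_smul₀ hm hfin]
    simp only [e]
  constructor
  · have h := ProbabilityTheory.integrable_pow_mul_exp_of_mem_interior_integrableExpSet hs2 k
    rw [hν, integrable_withDensity_iff_integrable_smul₀' hm hfin] at h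
    simp only [e] at h
    exact h
  · have h := ProbabilityTheory.hasDerivAt_integral_pow_mul_exp_real hs2 k
    simpa only [hint] using h

theorem integrableOn_eval_mul (hs : s ∈ todaDomain V J) (q : ℝ[X]) :
    IntegrableOn (fun y => q.eval y * todaWeight V s y) J := by
  induction q using Polynomial.induction_on' with
  | add p q hp hq =>
    simp only [eval_add, add_mul]
    exact hp.add hq
  | monomial k c =>
    simp only [eval_monomial, mul_assoc]
    exact (integrable_pow_and_hasDerivAt hs k).1.const_mul c

/-- Being built from moments, the functional is linear for every s, even where a divergent integral
takes its default value 0; on `todaDomain` it is the genuine integral. -/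
theorem weightFunctional_eq_integral (hs : s ∈ todaDomain V J) (q : ℝ[X]) :
    weightFunctional V J s q = ∫ y in J, q.eval y * todaWeight V s y := by
  induction q using Polynomial.induction_on' with
  | add p q hp hq =>
    rw [map_add, hp, hq, ← integral_add (integrableOn_eval_mul hs p) (integrableOn_eval_mul hs q)]
    simp only [eval_add, add_mul]
  | monomial k c =>
    simp only [weightFunctional_monomial, eval_monomial, mul_assoc, integral_const_mul]

theorem hasDerivAt_weightFunctional (hs : s ∈ todaDomain V J) (q : ℝ[X]) :
    HasDerivAt (fun u => weightFunctional V J u q) (weightFunctional V J s (X * q)) s := by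
  refine hasDerivAt_of_monomial (L' := weightFunctional V J s ∘ₗ LinearMap.mulLeft ℝ X)
    (fun k => ?_) q
  simpa [weightFunctional_monomial] using (integrable_pow_and_hasDerivAt hs k).2

/-- A nonzero polynomial has finitely many roots, so its square times the weight is positive almost
everywhere on J. -/
theorem isPos_weightFunctional (hs : s ∈ todaDomain V J) (hJ : volume J ≠ 0) :
    IsPos (weightFunctional V J s) := by
  intro q hq
  have hi := integrableOn_eval_mul hs (q * q)
  rw [weightFunctional_eq_integral hs, setIntegral_pos_iff_support_of_nonneg_ae _ hi]
  · have hsub : J \ (q.roots.toFinset : Set ℝ) ⊆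
        (Function.support fun y => (q * q).eval y * todaWeight V s y) ∩ J := by
      rintro y ⟨hy, hr⟩
      refine ⟨?_, hy⟩
      have : q.eval y ≠ 0 := fun h => hr (by simpa [hq] using h)
      simp [this, (todaWeight_pos V s y).ne']
    refine lt_of_lt_of_le ?_ (measure_mono hsub)
    rw [measure_sdiff_null (Finset.measure_zero _ _)]
    exact pos_iff_ne_zero.2 hJ
  · refine Eventually.of_forall fun y => ?_
    simp only [Pi.zero_apply, eval_mul]
    exact mul_nonneg (mul_self_nonneg _) (todaWeight_pos V s y).le

/-- The matrix integral is the product of the squared norms of the orthogonal polynomials. -/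
theorem matrixIntegral_eq_prod (hs : s ∈ todaDomain V J) (hJ : volume J ≠ 0) (n : ℕ) :
    matrixIntegral V n J s = ∏ j ∈ Finset.range n, nrm (weightFunctional V J s) j := by
  set L := weightFunctional V J s with hL
  have hpos : IsPos L := isPos_weightFunctional hs hJ
  have hort : ∀ i j : ℕ, i ≠ j → L (op L i * op L j) = 0 := by
    intro i j hij
    rcases lt_or_gt_of_ne hij with h | h
    · rw [mul_comm]; exact hpos.orthogonal j i h
    · exact hpos.orthogonal i j h
  let F : Equiv.Perm (Fin n) → Equiv.Perm (Fin n) → Fin n → ℝ → ℝ := fun σ τ i y =>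
    (op L (σ i) * op L (τ i)).eval y * todaWeight V s y
  have hexp : ∀ x : Fin n → ℝ,
      (Matrix.vandermonde x).det ^ 2 * ∏ i, todaWeight V s (x i) =
      ∑ σ : Equiv.Perm (Fin n), ∑ τ : Equiv.Perm (Fin n),
        ((Equiv.Perm.sign σ : ℤ) * (Equiv.Perm.sign τ : ℤ) : ℝ) * ∏ i, F σ τ i (x i) := by
    intro x
    -- Column operations replace the powers in the Vandermonde determinant by the monic p_j.
    rw [Matrix.det_eval_matrixOfPolynomials_eq_det_vandermonde x (fun j => op L j)
      (fun j => natDegree_op L j) (fun j => op_monic L j), ← Matrix.det_transpose,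
      Matrix.det_apply', sq, Finset.sum_mul_sum, Finset.sum_mul]
    refine Finset.sum_congr rfl fun σ _ => ?_
    rw [Finset.sum_mul]
    refine Finset.sum_congr rfl fun τ _ => ?_
    simp only [F, eval_mul, Finset.prod_mul_distrib, Matrix.transpose_apply, Matrix.of_apply]
    ring
  have hint : ∀ σ τ, Integrable (fun x : Fin n → ℝ => ∏ i, F σ τ i (x i))
      (Measure.pi fun _ => volume.restrict J) := fun σ τ =>
    Integrable.fintype_prod fun i => integrableOn_eval_mul hs _
  have hval : ∀ σ τ, ∫ x : Fin n → ℝ, ∏ i, F σ τ i (x i)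
      ∂(Measure.pi fun _ => volume.restrict J) = ∏ i, L (op L (σ i) * op L (τ i)) := by
    intro σ τ
    rw [integral_fintype_prod_eq_prod]
    exact Finset.prod_congr rfl fun i _ => (weightFunctional_eq_integral hs _).symm
  rw [matrixIntegral, volume_pi, Measure.restrict_pi_pi]
  simp only [hexp]
  rw [integral_finsetSum _ fun σ _ => integrable_finsetSum _ fun τ _ => (hint σ τ).const_mul _]
  -- By orthogonality only τ = σ survives; each of the n! choices of σ then contributes the same
  -- product, which cancels 1/n!.
  have hσ : ∀ σ : Equiv.Perm (Fin n), ∫ x : Fin n → ℝ, ∑ τ : Equiv.Perm (Fin n),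
        ((Equiv.Perm.sign σ : ℤ) * (Equiv.Perm.sign τ : ℤ) : ℝ) * ∏ i, F σ τ i (x i)
        ∂(Measure.pi fun _ => volume.restrict J) = ∏ j ∈ Finset.range n, nrm L j := by
    intro σ
    rw [integral_finsetSum _ fun τ _ => (hint σ τ).const_mul _,
      Finset.sum_eq_single_of_mem σ (Finset.mem_univ _)]
    · rw [integral_const_mul, hval]
      have h1 : ((Equiv.Perm.sign σ : ℤ) * (Equiv.Perm.sign σ : ℤ) : ℝ) = 1 := by
        rw [← Int.cast_mul, ← Units.val_mul, Int.units_mul_self]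
        simp
      rw [h1, one_mul, Finset.prod_range]
      exact Equiv.prod_comp σ fun j : Fin n => nrm L j
    · intro τ _ hτ
      obtain ⟨i, hi⟩ : ∃ i, τ i ≠ σ i := by
        by_contra! h
        exact hτ (Equiv.ext h)
      rw [integral_const_mul, hval, Finset.prod_eq_zero (Finset.mem_univ i), mul_zero]
      exact hort _ _ fun h => hi (Fin.ext h.symm)
  simp only [hσ, Finset.sum_const, Finset.card_univ, Fintype.card_perm, Fintype.card_fin,
    nsmul_eq_mul]
  rw [← mul_assoc, inv_mul_cancel₀ (by exact_mod_cast n.factorial_ne_zero), one_mul]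

end moments

/-! ### The set J as a function of one endpoint -/

theorem eventually_between {m : ℕ} {b : Fin (2 * m) → EReal} (hb : StrictMono b)
    {k : Fin (2 * m)} {ξ : ℝ} (hk : b k = ξ) :
    ∀ᶠ y : ℝ in 𝓝 ξ, (∀ j < k, b j < y) ∧ ∀ j, k < j → (y : EReal) < b j := by
  have hc : Tendsto (fun y : ℝ => (y : EReal)) (𝓝 ξ) (𝓝 (ξ : EReal)) :=
    continuous_coe_real_ereal.tendsto ξ
  refine Eventually.and ?_ ?_
  · refine eventually_all.2 fun j => ?_
    by_cases h : j < k
    · filter_upwards [hc.eventually (lt_mem_nhds (hk ▸ hb h))] with y hy _ using hy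
    · exact Eventually.of_forall fun y h' => absurd h' h
  · refine eventually_all.2 fun j => ?_
    by_cases h : k < j
    · filter_upwards [hc.eventually (gt_mem_nhds (hk ▸ hb h))] with y hy _ using hy
    · exact Eventually.of_forall fun y h' => absurd h' h

/-- Membership in the union of intervals near the moving endpoint and away from it. -/
theorem mem_intervalUnion_update {m : ℕ} {a : Fin (2 * m) → EReal} {k : Fin (2 * m)} {α β : ℝ}
    (hlt : ∀ y ∈ Icc α β, ∀ j < k, a j < (y : EReal))
    (hgt : ∀ y ∈ Icc α β, ∀ j, k < j → (y : EReal) < a j) {x : ℝ} (hx : x ∈ Ioo α β) (y : ℝ) :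
    (y ∈ Ioo α β → (y ∈ intervalUnion (Function.update a k (x : EReal)) ↔
      if (k : ℕ) % 2 = 0 then x < y else y < x)) ∧
    (y ∉ Ioo α β → ∀ x' ∈ Ioo α β, y ∈ intervalUnion (Function.update a k (x : EReal)) →
      y ∈ intervalUnion (Function.update a k (x' : EReal))) := by
  have hupd : ∀ (z : ℝ) (j : Fin (2 * m)), j ≠ k → Function.update a k (z : EReal) j = a j :=
    fun z j h => Function.update_of_ne h _ _
  constructor
  · intro hy
    have hy' := Ioo_subset_Icc_self hy
    simp only [intervalUnion, mem_iUnion, mem_ofPred_eq]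
    constructor
    · rintro ⟨i, h1, h2⟩
      by_cases e1 : (⟨2 * i, by omega⟩ : Fin (2 * m)) = k
      · have e : (k : ℕ) % 2 = 0 := by rw [← e1]; simp
        rw [if_pos e]
        rw [e1, Function.update_self] at h1
        exact_mod_cast h1
      · by_cases e2 : (⟨2 * i + 1, by omega⟩ : Fin (2 * m)) = k
        · have e : (k : ℕ) % 2 ≠ 0 := by rw [← e2]; simp [Nat.add_mod]
          rw [if_neg e]
          rw [e2, Function.update_self] at h2
          exact_mod_cast h2
        -- An interval not bounded by the k-th endpoint misses (α, β): all endpoints of smaller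
        -- index lie to the left of it and all of larger index to the right.
        · exfalso
          rw [hupd _ _ e1] at h1
          rw [hupd _ _ e2] at h2
          rcases lt_or_gt_of_ne e2 with h | h
          · exact lt_asymm h2 (hlt y hy' _ h)
          · refine lt_asymm h1 (hgt y hy' _ (lt_of_le_of_ne ?_ (Ne.symm e1)))
            rw [Fin.le_def]
            rw [Fin.lt_def] at h
            simp only at h ⊢
            omega
    · intro h
      -- The k-th endpoint belongs to interval k / 2, as its left end exactly when k is even.
      refine ⟨⟨(k : ℕ) / 2, by omega⟩, ?_⟩
      split_ifs at h with hk
      · have e1 : (⟨2 * ((k : ℕ) / 2), by omega⟩ : Fin (2 * m)) = k := Fin.ext (by simp; omega)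
        have e2 : k < (⟨2 * ((k : ℕ) / 2) + 1, by omega⟩ : Fin (2 * m)) := by
          rw [Fin.lt_def]; simp only; omega
        simp only
        rw [hupd _ _ e2.ne', e1, Function.update_self]
        exact ⟨by exact_mod_cast h, hgt y hy' _ e2⟩
      · have e1 : (⟨2 * ((k : ℕ) / 2) + 1, by omega⟩ : Fin (2 * m)) = k :=
          Fin.ext (by simp only; omega)
        have e2 : (⟨2 * ((k : ℕ) / 2), by omega⟩ : Fin (2 * m)) < k := by
          rw [Fin.lt_def]; simp only; omega
        simp only
        rw [hupd _ _ e2.ne, e1, Function.update_self]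
        exact ⟨hlt y hy' _ e2, by exact_mod_cast h⟩
  · intro hy x' hx'
    -- A point outside (α, β) compares in the same way with every position of the endpoint inside.
    have hcmp : ∀ z ∈ Ioo α β, (z < y ↔ β ≤ y) ∧ (y < z ↔ y ≤ α) := by
      intro z hz
      simp only [mem_Ioo, not_and_or, not_lt] at hy hz
      constructor <;> constructor <;> intro h <;> rcases hy with hy | hy <;> linarith
    simp only [intervalUnion, mem_iUnion, mem_ofPred_eq]
    rintro ⟨i, h1, h2⟩
    refine ⟨i, ?_, ?_⟩
    · by_cases e : (⟨2 * i, by omega⟩ : Fin (2 * m)) = k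
      · rw [e, Function.update_self, EReal.coe_lt_coe_iff] at h1 ⊢
        exact (hcmp x' hx').1.2 ((hcmp x hx).1.1 h1)
      · rwa [hupd _ _ e] at h1 ⊢
    · by_cases e : (⟨2 * i + 1, by omega⟩ : Fin (2 * m)) = k
      · rw [e, Function.update_self, EReal.coe_lt_coe_iff] at h2 ⊢
        exact (hcmp x' hx').2.2 ((hcmp x hx).2.1 h2)
      · rwa [hupd _ _ e] at h2 ⊢

/-- The union of intervals as a function of the moving endpoint. -/
theorem intervalUnion_update_eq {m : ℕ} {a : Fin (2 * m) → EReal} {k : Fin (2 * m)} {α β ξ : ℝ}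
    (hlt : ∀ y ∈ Icc α β, ∀ j < k, a j < (y : EReal))
    (hgt : ∀ y ∈ Icc α β, ∀ j, k < j → (y : EReal) < a j) (hξ : ξ ∈ Ioo α β) {x : ℝ}
    (hx : x ∈ Ioo α β) :
    intervalUnion (Function.update a k (x : EReal)) =
      (intervalUnion (Function.update a k (ξ : EReal)) \ Ioo α β) ∪
        if (k : ℕ) % 2 = 0 then Ioo x β else Ioo α x := by
  ext y
  have hX := mem_intervalUnion_update hlt hgt hx y
  have hΞ := mem_intervalUnion_update hlt hgt hξ y
  by_cases hy : y ∈ Ioo α β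
  · rw [hX.1 hy]
    split_ifs with hk
    · simp [hy.2, hy]
    · simp [hy.1, hy]
  · have h1 : y ∉ (if (k : ℕ) % 2 = 0 then Ioo x β else Ioo α x) := by
      split_ifs
      · exact fun h => hy ⟨hx.1.trans h.1, h.2⟩
      · exact fun h => hy ⟨h.1, h.2.trans hx.2⟩
    have h2 : y ∈ intervalUnion (Function.update a k (x : EReal)) ↔
        y ∈ intervalUnion (Function.update a k (ξ : EReal)) :=
      ⟨hX.2 hy ξ hξ, hΞ.2 hy x hx⟩
    simp only [mem_union, Set.mem_sdiff, h1, hy, or_false, not_false_eq_true, and_true, h2]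

/-- Integrability over, and differentiation of the integral over, a set with a moving endpoint. -/
theorem integrableOn_and_hasDerivAt_of_endpoint {J : ℝ → Set ℝ} {J₀ : Set ℝ} {α β ξ : ℝ}
    {p : Prop} [Decidable p] {f : ℝ → ℝ} (hJ₀ : Disjoint J₀ (Ioo α β))
    (hJ : ∀ x ∈ Ioo α β, J x = J₀ ∪ if p then Ioo x β else Ioo α x) (hξ : ξ ∈ Ioo α β)
    (hf : ContinuousOn f (Icc α β)) (hi : IntegrableOn f (J ξ)) {x : ℝ} (hx : x ∈ Ioo α β) :
    IntegrableOn f (J x) ∧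
      HasDerivAt (fun y => ∫ z in J y, f z) ((if p then -1 else 1) * f x) x := by
  have hI : IntegrableOn f (Icc α β) := hf.integrableOn_Icc
  have h0 : IntegrableOn f J₀ := hi.mono_set (by rw [hJ ξ hξ]; exact subset_union_left)
  have hsub : ∀ x ∈ Ioo α β, (if p then Ioo x β else Ioo α x) ⊆ Ioo α β := by
    intro x hx
    split_ifs
    · exact Ioo_subset_Ioo_left hx.1.le
    · exact Ioo_subset_Ioo_right hx.2.le
  have h1 : ∀ x ∈ Ioo α β, IntegrableOn f (if p then Ioo x β else Ioo α x) := fun x hx =>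
    hI.mono_set ((hsub x hx).trans Ioo_subset_Icc_self)
  refine ⟨by rw [hJ x hx]; exact h0.union (h1 x hx), ?_⟩
  have e : (fun y => ∫ z in J y, f z) =ᶠ[𝓝 x]
      fun y => (∫ z in J₀, f z) + if p then ∫ z in y..β, f z else ∫ z in α..y, f z := by
    filter_upwards [isOpen_Ioo.mem_nhds hx] with y hy
    rw [hJ y hy, setIntegral_union (hJ₀.mono_right (hsub y hy)) _ h0 (h1 y hy)]
    · split_ifs
      · rw [intervalIntegral.integral_of_le hy.2.le, integral_Ioc_eq_integral_Ioo]
      · rw [intervalIntegral.integral_of_le hy.1.le, integral_Ioc_eq_integral_Ioo]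
    · split_ifs <;> exact measurableSet_Ioo
  refine HasDerivAt.congr_of_eventuallyEq ?_ e
  have hm : StronglyMeasurableAtFilter f (𝓝 x) :=
    (hf.mono Ioo_subset_Icc_self).stronglyMeasurableAtFilter isOpen_Ioo x hx
  have hc : ContinuousAt f x := hf.continuousAt (Icc_mem_nhds hx.1 hx.2)
  split_ifs
  · refine ((intervalIntegral.integral_hasDerivAt_left ?_ hm hc).const_add _).congr_deriv (by ring)
    refine (hf.mono ?_).intervalIntegrable
    rw [uIcc_of_le hx.2.le]
    exact Icc_subset_Icc_left hx.1.le
  · refine ((intervalIntegral.integral_hasDerivAt_right ?_ hm hc).const_add _).congr_deriv (by ring)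
    refine (hf.mono ?_).intervalIntegrable
    rw [uIcc_of_le hx.1.le]
    exact Icc_subset_Icc_right hx.2.le

end OrthoPoly

/-! ### Assembly -/

theorem theorem8 (V : ℝ → ℝ) (n m : ℕ) (a : Fin (2 * m) → EReal) (k : Fin (2 * m)) (ξ t : ℝ)
    (ha : StrictMono (Function.update a k (ξ : EReal)))
    (hV : ∀ᶠ x in 𝓝 ξ, DifferentiableAt ℝ V x)
    (ht : ∀ᶠ s in 𝓝 t, IntegrableOn (fun x => todaWeight V s x)
      (intervalUnion (Function.update a k (ξ : EReal)))) :
    -- the matrix integrals are positive, so that the logarithm is meaningful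
    0 < matrixIntegral V n (intervalUnion (Function.update a k (ξ : EReal))) t ∧
    0 < matrixIntegral V (n + 1) (intervalUnion (Function.update a k (ξ : EReal))) t ∧
    ∀ T : ℝ → ℝ → ℝ, T = logRatio V a k n →
      -- all partial derivatives that occur in the equation exist
      DifferentiableAt ℝ (fun x => T x t) ξ ∧
      DifferentiableAt ℝ (fun x => dXi T x t) ξ ∧
      DifferentiableAt ℝ (fun s => T ξ s) t ∧
      DifferentiableAt ℝ (fun s => dT T ξ s) t ∧
      DifferentiableAt ℝ (fun s => dXi T ξ s) t ∧
      DifferentiableAt ℝ (fun s => dT (dXi T) ξ s) t ∧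
      DifferentiableAt ℝ (fun s => dXi (dXi T) ξ s) t ∧
      DifferentiableAt ℝ (fun s => dT (dXi (dXi T)) ξ s) t ∧
      -- the equation
      (dXi T ξ t ≠ 0 →
        dT (dT (dXi (dXi T))) ξ t
          - dT (dT (dXi T)) ξ t * dXi (dXi T) ξ t / dXi T ξ t
          - (dXi T ξ t) ^ 2 * dT (dT T) ξ t
          - dT (dXi T) ξ t * dT (dXi (dXi T)) ξ t / dXi T ξ t
          + (dT (dXi T) ξ t) ^ 2 * dXi (dXi T) ξ t / (dXi T ξ t) ^ 2
          + (ξ - dT T ξ t) * dXi T ξ t * (2 * dT (dXi T) ξ t - 1) = 0) := by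
  open OrthoPoly in
  set J : ℝ → Set ℝ := fun x => intervalUnion (Function.update a k (x : EReal)) with hJdef
  have hbk : Function.update a k (ξ : EReal) k = ξ := Function.update_self ..
  -- Choose [α, β] around ξ so small that V is differentiable on it and it contains no other
  -- endpoint.
  obtain ⟨δ, hδ, hball⟩ := Metric.eventually_nhds_iff_ball.1 (hV.and (eventually_between ha hbk))
  obtain ⟨α, β, hξ, hαβ⟩ : ∃ α β : ℝ, ξ ∈ Ioo α β ∧ Icc α β ⊆ Metric.ball ξ δ := by
    refine ⟨ξ - δ / 2, ξ + δ / 2, ⟨by linarith, by linarith⟩, fun y hy => ?_⟩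
    rw [Metric.mem_ball, Real.dist_eq, abs_lt]
    constructor <;> linarith [hy.1, hy.2]
  have hlt : ∀ y ∈ Icc α β, ∀ j < k, a j < (y : EReal) := fun y hy j hj => by
    simpa [Function.update_of_ne hj.ne] using (hball y (hαβ hy)).2.1 j hj
  have hgt : ∀ y ∈ Icc α β, ∀ j, k < j → (y : EReal) < a j := fun y hy j hj => by
    simpa [Function.update_of_ne hj.ne'] using (hball y (hαβ hy)).2.2 j hj
  have hJ : ∀ x ∈ Ioo α β, J x = (J ξ \ Ioo α β) ∪
      if (k : ℕ) % 2 = 0 then Ioo x β else Ioo α x :=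
    fun x hx => intervalUnion_update_eq hlt hgt hξ hx
  have hVc : ContinuousOn V (Icc α β) := fun y hy =>
    (hball y (hαβ hy)).1.continuousAt.continuousWithinAt
  have hwc : ∀ (i : ℕ) (s : ℝ), ContinuousOn (fun y => y ^ i * todaWeight V s y) (Icc α β) := by
    intro i s
    unfold todaWeight
    fun_prop
  have hend := fun (i : ℕ) (s : ℝ) (hi : IntegrableOn (fun y => y ^ i * todaWeight V s y) (J ξ))
      {x : ℝ} (hx : x ∈ Ioo α β) =>
    integrableOn_and_hasDerivAt_of_endpoint disjoint_sdiff_left hJ hξ (hwc i s) hi hx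
  set N := todaDomain V (J ξ) with hNdef
  have htN : t ∈ N := mem_interior_iff_mem_nhds.2 ht
  -- Moving the endpoint changes J only within [α, β], where the weight is continuous, so one open
  -- set of parameters s serves all x.
  have hdom : ∀ x ∈ Ioo α β, N ⊆ todaDomain V (J x) := fun x hx =>
    interior_mono fun s hs => by
      simpa using (hend 0 s (by simpa using hs) hx).1
  have hvol : ∀ x ∈ Ioo α β, volume (J x) ≠ 0 := by
    intro x hx h0
    rw [hJ x hx, measure_union_null_iff] at h0
    have h1 := h0.2
    split_ifs at h1
    · simp [hx.2.not_ge] at h1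
    · simp [hx.1.not_ge] at h1
  have hpos : ∀ x ∈ Ioo α β, ∀ s ∈ N, IsPos (weightFunctional V (J x) s) := fun x hx s hs =>
    isPos_weightFunctional (hdom x hx hs) (hvol x hx)
  have hτ : ∀ x ∈ Ioo α β, ∀ s ∈ N, ∀ n, matrixIntegral V n (J x) s =
      ∏ j ∈ Finset.range n, nrm (weightFunctional V (J x) s) j := fun x hx s hs n =>
    matrixIntegral_eq_prod (hdom x hx hs) (hvol x hx) n
  have hprod : ∀ x ∈ Ioo α β, ∀ s ∈ N, ∀ n,
      0 < ∏ j ∈ Finset.range n, nrm (weightFunctional V (J x) s) j := fun x hx s hs n =>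
    Finset.prod_pos fun j _ => (hpos x hx s hs).nrm_pos j
  refine ⟨?_, ?_, ?_⟩
  · exact (hτ ξ hξ t htN n).symm ▸ hprod ξ hξ t htN n
  · exact (hτ ξ hξ t htN (n + 1)).symm ▸ hprod ξ hξ t htN (n + 1)
  rintro T rfl
  refine pde_of_functional (L := fun x s => weightFunctional V (J x) s) (U := Ioo α β) (N := N)
    (ε := if (k : ℕ) % 2 = 0 then -1 else 1) n (isOpen_Ioo.mem_nhds hξ)
    (isOpen_interior.mem_nhds htN) isOpen_Ioo isOpen_interior hV.self_of_nhds hpos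
    (fun x hx s hs q => hasDerivAt_weightFunctional (hdom x hx hs) q) ?_ ?_
  · intro x hx s hs q
    refine hasDerivAt_of_monomial (L := fun y => weightFunctional V (J y) s)
      (L' := ((if (k : ℕ) % 2 = 0 then -1 else 1) * todaWeight V s x) • leval x)
      (fun i => ?_) q
    simp only [weightFunctional_monomial, one_mul]
    refine (hend i s (integrable_pow_and_hasDerivAt hs i).1 hx).2.congr_deriv ?_
    simp only [LinearMap.smul_apply, leval_apply, eval_monomial, smul_eq_mul]
    ring
  · intro x hx s hs
    have h1 := hτ x hx s hs (n + 1)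
    have h2 := hτ x hx s hs n
    simp only [hJdef] at h1 h2
    -- The quotient of the two products of norms is h_n.
    rw [logRatio, h1, h2, Finset.prod_range_succ, mul_div_assoc, mul_comm, div_mul_cancel₀]
    exact (hprod x hx s hs n).ne'
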